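/- Let $(\Omega,\mathcal F,(\mathcal F_t)_{t\ge 0},P)$ be a filtered probability space with a standard $d$-dimensional Brownian motion $B$, let $T>0$, and let $X$ be an $\mathbb R^m$-valued solution on $[0,T]$ of the stochastic differential equation $dX_t=b(t,X_t)\,dt+\sigma(t,X_t)\,dB_t$, $X_0=x\in\mathbb R^m$, with Borel measurable coefficients $b,\sigma$. Assume that each component $X^i_T$ lies in the Malliavin–Sobolev space $\mathbb D^{1,2}$, let $DX^i_T\colon\Omega\to L^2([0,T],\mathbb R^d)$ be its Malliavin derivative, and let $\gamma_{X_T}$ be the Malliavin matrix, $\gamma_{X_T}(i,j)=\langle DX^i_T,DX^j_T\rangle_{L^2([0,T])}$. Assume that $\gamma_{X_T}$ is almost surely invertible. For $k=1,\dots,m$ put $$u_k=\sum_{j=1}^m\gamma_{X_T}^{-1}(k,j)\,DX^j_T ,$$ and let $V=\operatorname{span}\{DX^1_T,\dots,DX^m_T\}\subset L^2([0,T],\mathbb R^d)$ (a random subspace). Say that $v\in L^2([0,T],\mathbb R^d)$ has the covering property for $k$ if $\langle DX^i_T,v\rangle_{L^2([0,T])}=\delta_{ik}$ for all $i=1,\dots,m$.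 Then, for every $k$: 1. Almost surely, $u_k$ is the unique element of $V$ that has the covering property for $k$. 2. Almost surely, the elements of $L^2([0,T],\mathbb R^d)$ that have the covering property for $k$ are exactly the vectors $u_k+w$ with $w\in V^\perp$, and there are infinitely many of them. Moreover, there are infinitely many strongly measurable random vector fields $U\colon\Omega\to L^2([0,T],\mathbb R^d)$, pairwise not almost surely equal, that almost surely have the covering property for $k$. -/

import Mathlib

open MeasureTheory ProbabilityTheory Filter Topology
open scoped NNReal ENNReal InnerProductSpace

namespace Malliavin

noncomputable section

/-- A standard `d`-dimensional Brownian motion relative to the filtration `𝓕`. -/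
structure IsBrownianMotion {Ω : Type*} {mΩ : MeasurableSpace Ω} {d : ℕ}
    (𝓕 : Filtration ℝ≥0 mΩ) (P : Measure Ω) (B : ℝ≥0 → Ω → EuclideanSpace ℝ (Fin d)) :
    Prop where
  coord : ∀ l : Fin d, IsBrownianReal (fun t ω => B t ω l) P
  coord_indep : iIndepFun (fun (l : Fin d) ω (t : ℝ≥0) => B t ω l) P
  adapted : StronglyAdapted 𝓕 B
  increment_indep : ∀ s t : ℝ≥0, s ≤ t →
    Indep (MeasurableSpace.comap (fun ω => B t ω - B s ω) inferInstance) (𝓕 s) P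

/-- A simple predictable `ℝ^d`-valued process `∑ j, ξ j * 1_{(left j, right j]}` with bounded
coefficients `ξ j` that are `𝓕 (left j)`-measurable. -/
structure SimpleProcess {Ω : Type*} {mΩ : MeasurableSpace Ω} (𝓕 : Filtration ℝ≥0 mΩ)
    (d : ℕ) where
  size : ℕ
  left : Fin size → ℝ≥0
  right : Fin size → ℝ≥0
  left_le_right : ∀ j, left j ≤ right j
  coeff : Fin size → Ω → EuclideanSpace ℝ (Fin d)
  measurable_coeff : ∀ j, StronglyMeasurable[𝓕 (left j)] (coeff j)
  bounded_coeff : ∃ C : ℝ, ∀ j ω, ‖coeff j ω‖ ≤ C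

/-- The value of a simple process at time `r`. -/
def SimpleProcess.eval {Ω : Type*} {mΩ : MeasurableSpace Ω} {𝓕 : Filtration ℝ≥0 mΩ} {d : ℕ}
    (S : SimpleProcess 𝓕 d) (r : ℝ) (ω : Ω) : EuclideanSpace ℝ (Fin d) :=
  ∑ j, Set.indicator (Set.Ioc (S.left j : ℝ) (S.right j : ℝ)) (fun _ => S.coeff j ω) r

/-- The elementary stochastic integral `∫_0^t S_r · dB_r` of a simple process. -/
def SimpleProcess.integral {Ω : Type*} {mΩ : MeasurableSpace Ω} {𝓕 : Filtration ℝ≥0 mΩ} {d : ℕ}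
    (S : SimpleProcess 𝓕 d) (B : ℝ≥0 → Ω → EuclideanSpace ℝ (Fin d)) (t : ℝ≥0) (ω : Ω) : ℝ :=
  ∑ j, ⟪S.coeff j ω, B (min (S.right j) t) ω - B (min (S.left j) t) ω⟫_ℝ

/-- `I` is (a version of) the Itô integral process `t ↦ ∫_0^t φ_r · dB_r`, `0 ≤ t ≤ T`: there are
simple processes `S n` with `∫_0^T |S n - φ|² dr → 0` in probability and
`sup_{t ≤ T} |∫_0^t S n · dB - I t| → 0` in probability. -/
def IsItoIntegral {Ω : Type*} {mΩ : MeasurableSpace Ω} {d : ℕ} (𝓕 : Filtration ℝ≥0 mΩ)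
    (P : Measure Ω) (B : ℝ≥0 → Ω → EuclideanSpace ℝ (Fin d)) (T : ℝ≥0)
    (φ : ℝ → Ω → EuclideanSpace ℝ (Fin d)) (I : ℝ≥0 → Ω → ℝ) : Prop :=
  ∃ S : ℕ → SimpleProcess 𝓕 d,
    (∀ ε : ℝ≥0∞, 0 < ε → Tendsto
      (fun n => P {ω | ε ≤ ∫⁻ r in Set.Icc (0 : ℝ) T, ‖(S n).eval r ω - φ r ω‖ₑ ^ 2})
      atTop (𝓝 0)) ∧
    (∀ ε : ℝ≥0∞, 0 < ε → Tendsto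
      (fun n => P {ω | ε ≤ ⨆ t : Set.Iic T, ‖(S n).integral B t ω - I t ω‖ₑ})
      atTop (𝓝 0))

/-- `X` is a solution on `[0, T]` of `dX_t = b(t, X_t) dt + σ(t, X_t) dB_t`, `X_0 = x`. -/
structure IsSDESolution {Ω : Type*} {mΩ : MeasurableSpace Ω} {d m : ℕ}
    (𝓕 : Filtration ℝ≥0 mΩ) (P : Measure Ω) (B : ℝ≥0 → Ω → EuclideanSpace ℝ (Fin d))
    (T : ℝ≥0) (b : ℝ → EuclideanSpace ℝ (Fin m) → EuclideanSpace ℝ (Fin m))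
    (σ : ℝ → EuclideanSpace ℝ (Fin m) → Matrix (Fin m) (Fin d) ℝ)
    (x : EuclideanSpace ℝ (Fin m)) (X : ℝ≥0 → Ω → EuclideanSpace ℝ (Fin m)) : Prop where
  adapted : StronglyAdapted 𝓕 X
  continuousOn : ∀ᵐ ω ∂P, ContinuousOn (fun t => X t ω) (Set.Iic T)
  drift_integrable : ∀ᵐ ω ∂P,
    IntervalIntegrable (fun r => b r (X r.toNNReal ω)) volume 0 T
  diffusion_integrable : ∀ᵐ ω ∂P, ∀ (i : Fin m) (l : Fin d),
    ∫⁻ r in Set.Icc (0 : ℝ) T, ‖σ r (X r.toNNReal ω) i l‖ₑ ^ 2 < ∞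
  equation : ∃ M : Fin m → ℝ≥0 → Ω → ℝ,
    (∀ i, IsItoIntegral 𝓕 P B T
      (fun r ω => WithLp.toLp 2 (fun l => σ r (X r.toNNReal ω) i l)) (M i)) ∧
    ∀ᵐ ω ∂P, ∀ t ≤ T, ∀ i,
      X t ω i = x i + (∫ r in (0 : ℝ)..t, b r (X r.toNNReal ω)) i + M i t ω

/-- The Hilbert space `L²([0, T], ℝ^d)`. -/
abbrev H (T : ℝ≥0) (d : ℕ) : Type :=
  Lp (EuclideanSpace ℝ (Fin d)) 2 (volume.restrict (Set.Icc (0 : ℝ) T))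

/-- `W` is (a version of) the Wiener integral `B(h) = ∫_0^T h(t) · dB_t`. -/
def IsWienerIntegral {Ω : Type*} {mΩ : MeasurableSpace Ω} {d : ℕ} (𝓕 : Filtration ℝ≥0 mΩ)
    (P : Measure Ω) (B : ℝ≥0 → Ω → EuclideanSpace ℝ (Fin d)) (T : ℝ≥0)
    (h : H T d) (W : Ω → ℝ) : Prop :=
  ∃ I : ℝ≥0 → Ω → ℝ, IsItoIntegral 𝓕 P B T (fun r _ => h r) I ∧ W =ᵐ[P] I T

/-- `F = f(B(h_1), …, B(h_n))` is a smooth cylindrical functional, `f` being smooth with all its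
derivatives of polynomial growth, and `DF = ∑ i, ∂_i f(B(h_1), …, B(h_n)) h_i`. -/
def IsCylindricalWithDeriv {Ω : Type*} {mΩ : MeasurableSpace Ω} {d : ℕ}
    (𝓕 : Filtration ℝ≥0 mΩ) (P : Measure Ω) (B : ℝ≥0 → Ω → EuclideanSpace ℝ (Fin d))
    (T : ℝ≥0) (F : Ω → ℝ) (DF : Ω → H T d) : Prop :=
  ∃ (n : ℕ) (f : EuclideanSpace ℝ (Fin n) → ℝ) (h : Fin n → H T d)
    (W : Fin n → Ω → ℝ),
    f.HasTemperateGrowth ∧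
    (∀ i, IsWienerIntegral 𝓕 P B T (h i) (W i)) ∧
    (∀ ω, F ω = f (WithLp.toLp 2 (fun i => W i ω))) ∧
    ∀ ω, DF ω = ∑ i,
      fderiv ℝ f (WithLp.toLp 2 (fun i => W i ω)) (EuclideanSpace.single i 1) • h i

/-- `F` belongs to the Malliavin–Sobolev space `𝔻^{1,2}` and `DF` is (a version of) its Malliavin
derivative, i.e. `(F, DF)` lies in the graph of the closure, in `L²(Ω) × L²(Ω; L²([0, T], ℝ^d))`,
of the derivative operator on smooth cylindrical functionals. -/
def IsMalliavinDeriv {Ω : Type*} {mΩ : MeasurableSpace Ω} {d : ℕ} (𝓕 : Filtration ℝ≥0 mΩ)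
    (P : Measure Ω) (B : ℝ≥0 → Ω → EuclideanSpace ℝ (Fin d)) (T : ℝ≥0)
    (F : Ω → ℝ) (DF : Ω → H T d) : Prop :=
  MemLp F 2 P ∧ MemLp DF 2 P ∧
  ∃ (G : ℕ → Ω → ℝ) (DG : ℕ → Ω → H T d),
    (∀ n, IsCylindricalWithDeriv 𝓕 P B T (G n) (DG n)) ∧
    Tendsto (fun n => eLpNorm (fun ω => G n ω - F ω) 2 P) atTop (𝓝 0) ∧
    Tendsto (fun n => eLpNorm (fun ω => DG n ω - DF ω) 2 P) atTop (𝓝 0)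

/-- The Malliavin matrix `γ(i, j) = ⟨DX^i, DX^j⟩`. -/
def malliavinMatrix {Ω : Type*} {m d : ℕ} {T : ℝ≥0} (DX : Fin m → Ω → H T d) (ω : Ω) :
    Matrix (Fin m) (Fin m) ℝ :=
  Matrix.of fun i j => ⟪DX i ω, DX j ω⟫_ℝ

/-- The covering vector field `u_k = ∑ j, γ⁻¹(k, j) DX^j`. -/
def coveringField {Ω : Type*} {m d : ℕ} {T : ℝ≥0} (DX : Fin m → Ω → H T d) (k : Fin m)
    (ω : Ω) : H T d :=
  ∑ j, (malliavinMatrix DX ω)⁻¹ k j • DX j ω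

/-- The subspace `V = span {DX^1, …, DX^m}` of `L²([0, T], ℝ^d)`. -/
def derivSpan {Ω : Type*} {m d : ℕ} {T : ℝ≥0} (DX : Fin m → Ω → H T d) (ω : Ω) :
    Submodule ℝ (H T d) :=
  Submodule.span ℝ (Set.range fun i => DX i ω)

/-- The covering property at `ω` for the index `k`: `⟨DX^i, v⟩ = δ_{ik}` for all `i`. -/
def Covers {Ω : Type*} {m d : ℕ} {T : ℝ≥0} (DX : Fin m → Ω → H T d) (k : Fin m) (ω : Ω)
    (v : H T d) : Prop :=
  ∀ i, ⟪DX i ω, v⟫_ℝ = if i = k then 1 else 0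

end

end Malliavin

/-! For fixed `ω` this is linear algebra. When the Gram matrix of the `DX^i` is invertible, its
inverse turns them into the dual basis `u_k` of `V`. The covering conditions are affine in `v`, with
homogeneous solution space `Vᗮ`, and `V ∩ Vᗮ = 0` gives uniqueness in `V` (`covers_iff`).

Infinitude needs a nonzero vector of `Vᗮ`. Since `dim V ≤ m`, among `m + 1` independent vectors of
`L²` one has nonzero component orthogonal to `V` (`exists_orthogonalPart_ne_zero`), and adding its
real multiples to `u_k` suffices. With deterministic vectors this component is a measurable function
of `ω`, which yields the random fields. -/

namespace Malliavin

noncomputable section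

section DualVector

variable {E : Type*} [NormedAddCommGroup E] [InnerProductSpace ℝ E] {m : ℕ}

/-- The combination of the vectors `v j` with coefficients the `k`-th row of the inverse of their
Gram matrix. -/
def dualVector (v : Fin m → E) (k : Fin m) : E :=
  ∑ j, (Matrix.gram ℝ v)⁻¹ k j • v j

theorem dualVector_mem_span (v : Fin m → E) (k : Fin m) :
    dualVector v k ∈ Submodule.span ℝ (Set.range v) :=
  Submodule.sum_mem _ fun j _ =>
    Submodule.smul_mem _ _ (Submodule.subset_span (Set.mem_range_self j))

theorem inner_dualVector {v : Fin m → E} (hv : IsUnit (Matrix.gram ℝ v)) (i k : Fin m) :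
    ⟪v i, dualVector v k⟫_ℝ = if i = k then 1 else 0 := by
  -- This is the `(k, i)` entry of `γ⁻¹ γ = 1`.
  have h := congrFun (congrFun
    (Matrix.nonsing_inv_mul _ ((Matrix.isUnit_iff_isUnit_det _).1 hv)) k) i
  rw [Matrix.mul_apply, Matrix.one_apply] at h
  simp only [dualVector, inner_sum, inner_smul_right, eq_comm (a := i), ← h, Matrix.gram_apply]
  exact Finset.sum_congr rfl fun j _ => by rw [real_inner_comm]

theorem mem_orthogonal_span_range_iff (v : Fin m → E) (w : E) :
    w ∈ (Submodule.span ℝ (Set.range v))ᗮ ↔ ∀ i, ⟪v i, w⟫_ℝ = 0 := by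
  refine ⟨fun h i => (Submodule.mem_orthogonal _ _).1 h _
    (Submodule.subset_span (Set.mem_range_self i)), fun h => ?_⟩
  refine (Submodule.mem_orthogonal _ _).2 fun u hu => ?_
  induction hu using Submodule.span_induction with
  | mem x hx => obtain ⟨i, rfl⟩ := hx; exact h i
  | zero => exact inner_zero_left _
  | add x y _ _ hx hy => rw [inner_add_left, hx, hy, add_zero]
  | smul a x _ hx => rw [inner_smul_left, hx, mul_zero]

theorem forall_inner_eq_iff_sub_dualVector_mem {v : Fin m → E} (hv : IsUnit (Matrix.gram ℝ v))
    (k : Fin m) (u : E) :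
    (∀ i, ⟪v i, u⟫_ℝ = if i = k then 1 else 0) ↔
      u - dualVector v k ∈ (Submodule.span ℝ (Set.range v))ᗮ := by
  simp only [mem_orthogonal_span_range_iff, inner_sub_right, inner_dualVector hv, sub_eq_zero]

/-- The component of `h` orthogonal to the vectors `v i`. -/
def orthogonalPart (v : Fin m → E) (h : E) : E :=
  h - ∑ i, ⟪v i, h⟫_ℝ • dualVector v i

theorem orthogonalPart_mem {v : Fin m → E} (hv : IsUnit (Matrix.gram ℝ v)) (h : E) :
    orthogonalPart v h ∈ (Submodule.span ℝ (Set.range v))ᗮ := by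
  rw [mem_orthogonal_span_range_iff]
  intro i
  simp [orthogonalPart, inner_sub_right, inner_sum, inner_smul_right, inner_dualVector hv]

/-- No invertibility is needed: `dualVector v i` lies in the span whatever the value of the inverse.
-/
theorem mem_span_of_orthogonalPart_eq_zero {v : Fin m → E} {h : E}
    (hz : orthogonalPart v h = 0) : h ∈ Submodule.span ℝ (Set.range v) := by
  rw [sub_eq_zero.1 hz]
  exact Submodule.sum_mem _ fun i _ => Submodule.smul_mem _ _ (dualVector_mem_span v i)

theorem exists_orthogonalPart_ne_zero (v : Fin m → E) {h : Fin (m + 1) → E}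
    (hh : LinearIndependent ℝ h) : ∃ n, orthogonalPart v (h n) ≠ 0 := by
  by_contra! hz
  have hle : Submodule.span ℝ (Set.range h) ≤ Submodule.span ℝ (Set.range v) :=
    Submodule.span_le.2 (Set.range_subset_iff.2 fun n =>
      mem_span_of_orthogonalPart_eq_zero (hz n))
  have : FiniteDimensional ℝ (Submodule.span ℝ (Set.range v)) :=
    FiniteDimensional.span_of_finite ℝ (Set.finite_range v)
  have h1 := Submodule.finrank_mono hle
  rw [finrank_span_eq_card hh, Fintype.card_fin] at h1
  have h2 := finrank_range_le_card (R := ℝ) v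
  rw [Set.finrank, Fintype.card_fin] at h2
  omega

end DualVector

section Measurability

variable {E : Type*} [NormedAddCommGroup E] [InnerProductSpace ℝ E] {m : ℕ}
  {Ω : Type*} {mΩ : MeasurableSpace Ω} {P : Measure Ω} {v : Fin m → Ω → E}

theorem aestronglyMeasurable_dualVector (hv : ∀ i, AEStronglyMeasurable (v i) P) (k : Fin m) :
    AEStronglyMeasurable (fun ω => dualVector (fun i => v i ω) k) P := by
  have hgram : AEMeasurable (fun ω i j => Matrix.gram ℝ (fun i => v i ω) i j) P :=
    aemeasurable_pi_lambda _ fun i => aemeasurable_pi_lambda _ fun j =>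
      ((hv i).inner (hv j)).aemeasurable
  have hinv (j : Fin m) : Measurable fun A : Fin m → Fin m → ℝ => (Matrix.of A)⁻¹ k j := by
    -- By the adjugate formula, with `0⁻¹ = 0`, the inverse is measurable on all matrices, singular
    -- ones included.
    simp only [Matrix.inv_def, Ring.inverse_eq_inv', Matrix.smul_apply, smul_eq_mul]
    have hdet : Continuous fun A : Fin m → Fin m → ℝ => (Matrix.of A).det :=
      Continuous.matrix_det continuous_id
    have hadj : Continuous fun A : Fin m → Fin m → ℝ => (Matrix.of A).adjugate k j :=
      (Continuous.matrix_adjugate continuous_id).matrix_elem k j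
    exact hdet.measurable.inv.mul hadj.measurable
  refine Finset.aestronglyMeasurable_fun_sum _ fun j _ => ?_
  exact ((hinv j).comp_aemeasurable hgram).aestronglyMeasurable.smul (hv j)

theorem aestronglyMeasurable_orthogonalPart (hv : ∀ i, AEStronglyMeasurable (v i) P) (h : E) :
    AEStronglyMeasurable (fun ω => orthogonalPart (fun i => v i ω) h) P :=
  aestronglyMeasurable_const.sub <| Finset.aestronglyMeasurable_fun_sum _ fun i _ =>
    ((hv i).inner aestronglyMeasurable_const).smul (aestronglyMeasurable_dualVector hv i)

end Measurability

/-- In positive dimension, `L²([0, T], ℝ^d)` contains an infinite linearly independent family. -/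
theorem exists_linearIndependent_H {T : ℝ≥0} (hT : 0 < T) {d : ℕ} (hd : 0 < d) :
    ∃ h : ℕ → H T d, LinearIndependent ℝ h := by
  set μ : Measure ℝ := volume.restrict (Set.Icc (0 : ℝ) T)
  have hT' : (0 : ℝ) < T := hT
  -- Consecutive points bound disjoint intervals of positive length in `[0, T]`, whose indicators
  -- are orthogonal.
  let a : ℕ → ℝ := fun n => T / (n + 1)
  have ha : StrictAnti a := fun i j hij => by
    have : (i : ℝ) < j := by exact_mod_cast hij
    exact div_lt_div_of_pos_left hT' (by positivity) (by linarith)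
  let s : ℕ → Set ℝ := fun n => Set.Ioc (a (n + 1)) (a n)
  have hs (n) : MeasurableSet (s n) := measurableSet_Ioc
  have hsub (n) : s n ⊆ Set.Icc 0 T := fun y hy =>
    ⟨(div_pos hT' (by positivity)).le.trans hy.1.le, hy.2.trans <| by
      simpa [a] using ha.antitone (Nat.zero_le n)⟩
  have hdisj : Pairwise fun i j => s i ∩ s j = ∅ := fun i j hij =>
    Set.disjoint_iff_inter_eq_empty.1 (ha.antitone.pairwise_disjoint_on_Ioc_succ hij)
  have hpos (n) : μ (s n) ≠ 0 := by
    rw [Measure.restrict_apply (hs n), Set.inter_eq_self_of_subset_left (hsub n), Real.volume_Ioc]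
    simpa using ha n.lt_succ_self
  let e : EuclideanSpace ℝ (Fin d) := EuclideanSpace.single ⟨0, hd⟩ 1
  refine ⟨fun n => indicatorConstLp 2 (hs n) (measure_ne_top μ _) e,
    linearIndependent_of_ne_zero_of_inner_eq_zero (fun n hn => ?_) fun i j hij => ?_⟩
  · have := congrArg norm hn
    rw [norm_indicatorConstLp (by simp) (by simp), norm_zero] at this
    have h0 : μ.real (s n) ≠ 0 := (measureReal_ne_zero_iff (measure_ne_top μ _)).2 (hpos n)
    have h1 : 0 < μ.real (s n) := lt_of_le_of_ne measureReal_nonneg h0.symm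
    have h2 : ‖e‖ = 1 := by simp [e]
    rw [h2, one_mul] at this
    exact (Real.rpow_pos_of_pos h1 _).ne' this
  · exact (L2.inner_indicatorConstLp_indicatorConstLp (hs i) (hs j) (measure_ne_top μ _)
      (measure_ne_top μ _) e e).trans (by simp [hdisj hij])

theorem covers_iff {Ω : Type*} {m d : ℕ} {T : ℝ≥0} {DX : Fin m → Ω → H T d} {k : Fin m} {ω : Ω}
    (hω : IsUnit (malliavinMatrix DX ω)) (u : H T d) :
    Covers DX k ω u ↔ u - coveringField DX k ω ∈ (derivSpan DX ω)ᗮ :=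
  forall_inner_eq_iff_sub_dualVector_mem hω k u

/-- An invertible Malliavin matrix of positive size forces the Brownian motion to have positive
dimension. -/
theorem dim_pos_of_isUnit {Ω : Type*} {m d : ℕ} {T : ℝ≥0} {DX : Fin m → Ω → H T d} (k : Fin m)
    {ω : Ω} (hω : IsUnit (malliavinMatrix DX ω)) : 0 < d := by
  rcases Nat.eq_zero_or_pos d with rfl | hd
  · have hz (y : H T 0) : y = 0 := Lp.ext (ae_of_all _ fun r => Subsingleton.elim _ _)
    have h := inner_dualVector hω k k
    rw [hz (DX k ω), inner_zero_left] at h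
    simp at h
  · exact hd

theorem infinite_setOf_covers {Ω : Type*} {m d : ℕ} {T : ℝ≥0} {DX : Fin m → Ω → H T d}
    {k : Fin m} {ω : Ω} (hω : IsUnit (malliavinMatrix DX ω)) {h : ℕ → H T d}
    (hh : LinearIndependent ℝ h) : {u : H T d | Covers DX k ω u}.Infinite := by
  obtain ⟨n, hn⟩ := exists_orthogonalPart_ne_zero (fun i => DX i ω)
    (hh.comp (Fin.val : Fin (m + 1) → ℕ) Fin.val_injective)
  refine Set.infinite_of_injective_forall_mem
    (f := fun c : ℝ => coveringField DX k ω + c • orthogonalPart (fun i => DX i ω) (h n))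
    (fun c c' hc => smul_left_injective ℝ hn (add_left_cancel hc)) fun c => ?_
  rw [Set.mem_ofPred_eq, covers_iff hω, add_sub_cancel_left]
  exact Submodule.smul_mem _ _ (orthogonalPart_mem hω _)

theorem infinite_setOf_ae_covers {Ω : Type*} {mΩ : MeasurableSpace Ω} {P : Measure Ω} [NeZero P]
    {m d : ℕ} {T : ℝ≥0} {DX : Fin m → Ω → H T d} (hDX : ∀ i, AEStronglyMeasurable (DX i) P)
    (hγ : ∀ᵐ ω ∂P, IsUnit (malliavinMatrix DX ω)) (k : Fin m) {h : ℕ → H T d}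
    (hh : LinearIndependent ℝ h) :
    {U : Ω →ₘ[P] H T d | ∀ᵐ ω ∂P, Covers DX k ω (U ω)}.Infinite := by
  -- The index must not depend on `ω`. If all `m + 1` orthogonal parts vanished a.s., they would
  -- vanish together at some `ω`, which is impossible.
  obtain ⟨n, hn⟩ : ∃ n : Fin (m + 1),
      ¬ ∀ᵐ ω ∂P, orthogonalPart (fun i => DX i ω) (h n) = 0 := by
    by_contra! hz
    obtain ⟨ω, hω⟩ := (ae_all_iff.2 hz).exists
    obtain ⟨n, hn⟩ := exists_orthogonalPart_ne_zero (fun i => DX i ω)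
      (hh.comp (Fin.val : Fin (m + 1) → ℕ) Fin.val_injective)
    exact hn (hω n)
  have hmeas (c : ℝ) : AEStronglyMeasurable
      (fun ω => coveringField DX k ω + c • orthogonalPart (fun i => DX i ω) (h n)) P :=
    (aestronglyMeasurable_dualVector hDX k).add
      ((aestronglyMeasurable_orthogonalPart hDX (h n)).const_smul c)
  refine Set.infinite_of_injective_forall_mem (f := fun c : ℝ => AEEqFun.mk _ (hmeas c))
    (fun c c' hc => ?_) fun c => ?_
  -- For `c ≠ c'`, a.s. equality would force the orthogonal part to vanish a.s.
  · by_contra hne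
    refine hn ?_
    filter_upwards [AEEqFun.mk_eq_mk.1 hc] with ω hω
    by_contra hz
    exact hne (smul_left_injective ℝ hz (add_left_cancel hω))
  · rw [Set.mem_ofPred_eq]
    filter_upwards [AEEqFun.coeFn_mk _ (hmeas c), hγ] with ω hω hunit
    rw [hω, covers_iff hunit, add_sub_cancel_left]
    exact Submodule.smul_mem _ _ (orthogonalPart_mem hunit _)

end

end Malliavin

theorem mainTheorem8 {Ω : Type*} {mΩ : MeasurableSpace Ω} (P : Measure Ω)
    [IsProbabilityMeasure P] (𝓕 : Filtration ℝ≥0 mΩ) (m d : ℕ) (T : ℝ≥0) (hT : 0 < T)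
    (B : ℝ≥0 → Ω → EuclideanSpace ℝ (Fin d)) (hB : Malliavin.IsBrownianMotion 𝓕 P B)
    (b : ℝ → EuclideanSpace ℝ (Fin m) → EuclideanSpace ℝ (Fin m))
    (hb : Measurable (Function.uncurry b))
    (σ : ℝ → EuclideanSpace ℝ (Fin m) → Matrix (Fin m) (Fin d) ℝ)
    (hσ : ∀ i l, Measurable (Function.uncurry fun r y => σ r y i l))
    (x : EuclideanSpace ℝ (Fin m)) (X : ℝ≥0 → Ω → EuclideanSpace ℝ (Fin m))
    (hX : Malliavin.IsSDESolution 𝓕 P B T b σ x X)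
    (DX : Fin m → Ω → Malliavin.H T d)
    (hDX : ∀ i, Malliavin.IsMalliavinDeriv 𝓕 P B T (fun ω => X T ω i) (DX i))
    (hγ : ∀ᵐ ω ∂P, IsUnit (Malliavin.malliavinMatrix DX ω))
    (k : Fin m) :
    (∀ᵐ ω ∂P,
      -- `u_k` is the unique element of `V` with the covering property
      (Malliavin.coveringField DX k ω ∈ Malliavin.derivSpan DX ω ∧
        Malliavin.Covers DX k ω (Malliavin.coveringField DX k ω) ∧
        ∀ v ∈ Malliavin.derivSpan DX ω, Malliavin.Covers DX k ω v →
          v = Malliavin.coveringField DX k ω) ∧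
      -- the elements of `L²([0, T], ℝ^d)` with the covering property are the `u_k + w`, `w ∈ Vᗮ`,
      -- and there are infinitely many of them
      (∀ u : Malliavin.H T d, Malliavin.Covers DX k ω u ↔
        ∃ w ∈ (Malliavin.derivSpan DX ω)ᗮ, u = Malliavin.coveringField DX k ω + w) ∧
      {u : Malliavin.H T d | Malliavin.Covers DX k ω u}.Infinite) ∧
    -- there are infinitely many random covering fields, up to almost sure equality
    {U : Ω →ₘ[P] Malliavin.H T d | ∀ᵐ ω ∂P, Malliavin.Covers DX k ω (U ω)}.Infinite := by
  obtain ⟨ω₀, hω₀⟩ := hγ.exists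
  obtain ⟨h, hh⟩ := Malliavin.exists_linearIndependent_H hT (Malliavin.dim_pos_of_isUnit k hω₀)
  refine ⟨?_, Malliavin.infinite_setOf_ae_covers (fun i => (hDX i).2.1.aestronglyMeasurable)
    hγ k hh⟩
  filter_upwards [hγ] with ω hω
  have hmem := Malliavin.dualVector_mem_span (fun i => DX i ω) k
  refine ⟨⟨hmem, fun i => Malliavin.inner_dualVector hω i k, fun v hv hcov => ?_⟩, fun u => ?_,
    Malliavin.infinite_setOf_covers hω hh⟩
  -- The difference `v - u_k` lies in both `V` and `Vᗮ`, so it is orthogonal to itself.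
  · have horth := (Malliavin.covers_iff hω v).1 hcov
    have := (Submodule.mem_orthogonal _ _).1 horth _ (Submodule.sub_mem _ hv hmem)
    exact sub_eq_zero.1 (inner_self_eq_zero.1 this)
  · rw [Malliavin.covers_iff hω]
    refine ⟨fun hu => ⟨_, hu, (add_sub_cancel _ _).symm⟩, ?_⟩
    rintro ⟨w, hw, rfl⟩
    rwa [add_sub_cancel_left]
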